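/- **Setting.** There are $n\ge 2$ agents and a set $G$ of $m\ge 1$ indivisible goods. Each agent $i$ reports a valuation $v_i=(v_{i,\ell})_{\ell\in G}$ of nonnegative reals, with no normalization and no upper bound, extended additively to bundles by $v_i(S)=\sum_{\ell\in S}v_{i,\ell}$. An allocation is a partition $A=(A_1,\dots,A_n)$ of $G$. It is EF1 (for a profile $v$) if for all agents $i,k$ either $v_i(A_i)\ge v_i(A_k)$ or $v_i(A_i)\ge v_i(A_k\setminus\{g\})$ for some $g\in A_k$. Agent $k$ is unenvied in $A$ if $v_i(A_i)\ge v_i(A_k)$ for every agent $i$. A mechanism is a function $f$ from profiles to allocations. **RAT-degree.** Given an agent $i$ with true valuation $T$, a set $K$ of agents not containing $i$, and valuations $(v_k)_{k\in K}$, a report $P\ne T$ is *profitable* if there are reports of the agents outside $K\cup\{i\}$ for which reporting $P$ gives $i$ a strictly larger true utility than reporting $T$. It is *safe* if for all reports of the agents outside $K\cup\{i\}$ reporting $P$ gives $i$ at least the true utility that reporting $T$ gives. The mechanism $f$ is $k$-known-agents safely-manipulable if for some $i$, some $T$, some $K$ with $|K|=k$ and some $(v_k)_{k\in K}$ there is a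 report $P\neq T$ that is both profitable and safe. The RAT-degree of $f$ is the least such $k$, or $n$ if there is none. **Priority functions.** A priority function $\Gamma$ maps each profile to a pair $(i^+,i^-)$ of agents, the favored and the unfavored one. It is *volatile* if for all agents $i\ne j$, $p\ne q$, $p'\ne q'$, every good $\ell^*$, all valuations $(v_k)_{k\ne i,j}$, and all valuations $v_i\ne v_i'$, there is a valuation $v_j$ with $v_{j,\ell^*}>0$ and $v_{j,\ell}=0$ for $\ell\ne\ell^*$ such that $\Gamma$ outputs $(p,q)$ on the profile with $v_i$ and $(p',q')$ on the profile with $v_i'$ (both with $v_j$ and the same $(v_k)_{k\neq i,j}$). The *binary priority function* is defined as follows. Let $N=\lfloor\max_{i,\ell}v_{i,\ell}\rfloor$, written in binary and padded with zeros as most significant bits. From the least significant bit on, it is read as: $L\ge 0$ bits $1$ and a bit $0$; $L$ bits giving an integer $|t|$; a bit giving the sign of $t$ ($0$ for nonnegative); and four blocks whose lengths are the binary lengths of $n$, $m$, $n(n-1)$, $n(n-1)$, giving an agent $i$ (modulo $n$), a good $\ell$ (modulo $m$), and integers $a$ and $b$. All further bits are ignored. Let $s=\lfloor v_{i,\ell}/2^{t}\rfloor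 \bmod 2$ be the bit of $v_{i,\ell}$ at position $t\in\mathbb Z$, and let $p=(as+b)\bmod n(n-1)$. Number the agents $0,\dots,n-1$. The output is the ordered pair $(i^+,i^-)$ with $i^+=\lfloor p/(n-1)\rfloor$ and $i^-=\bigl(i^++1+(p\bmod (n-1))\bigr)\bmod n$; this is a bijection between $\{0,\dots,n(n-1)-1\}$ and the ordered pairs of distinct agents. **The mechanism.** A *Volatile Priority mechanism* for a volatile $\Gamma$ is a mechanism that outputs, for each reported profile $v$ with $(i^+,i^-)=\Gamma(v)$, an allocation that maximizes $v_{i^+}(A_{i^+})$ among the EF1 allocations $A$ (with respect to the reports) in which $i^-$ is unenvied; ties are broken by an arbitrary fixed rule (any function of the profile). **Theorem.** Let $n\ge 2$ and $m\ge 1$. 1. The binary priority function is volatile, and it always outputs two different agents. In particular, a volatile priority function exists. 2. For every priority function $\Gamma$, a mechanism as described above (maximizing $v_{i^+}(A_{i^+})$ among the EF1 allocations in which $i^-$ is unenvied) exists. 3. For every volatile $\Gamma$, every Volatile Priority mechanism for $\Gamma$, however ties are broken, always outputs allocations that are EF1 with respect to the reports, and has RAT-degree exactly $n-1$. -/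

import Mathlib

open scoped NNReal

/-! ### Mechanisms, safe manipulations and the RAT-degree -/

section RAT

variable {ι : Type} [Fintype ι] [DecidableEq ι] {D : ι → Type} {X : Type}

/-- The preference profile `(P_i, P_K, P_{K̄})`: agent `i` reports `P`, the agents in `K` report
according to `Q`, all remaining agents according to `R`. -/
def combinedProfile (i : ι) (K : Finset ι) (P : D i) (Q R : ∀ j, D j) : ∀ j, D j :=
  Function.update (K.piecewise Q R) i P

/-- For agent `i` with true preferences `T`, reporting `P` is profitable given that the agents
in `K` have the preferences prescribed by `Q`. Here `u i T x` is the utility that agent `i`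
with preferences `T` has from the outcome `x`. -/
def ProfitableGiven (u : ∀ i, D i → X → ℝ) (f : (∀ i, D i) → X)
    (i : ι) (T P : D i) (K : Finset ι) (Q : ∀ j, D j) : Prop :=
  ∃ R : ∀ j, D j,
    u i T (f (combinedProfile i K T Q R)) < u i T (f (combinedProfile i K P Q R))

/-- For agent `i` with true preferences `T`, reporting `P` is safe given that the agents in `K`
have the preferences prescribed by `Q`. -/
def SafeGiven (u : ∀ i, D i → X → ℝ) (f : (∀ i, D i) → X)
    (i : ι) (T P : D i) (K : Finset ι) (Q : ∀ j, D j) : Prop :=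
  ∀ R : ∀ j, D j,
    u i T (f (combinedProfile i K T Q R)) ≤ u i T (f (combinedProfile i K P Q R))

/-- `f` is `k`-known-agents safely-manipulable. -/
def KnownAgentsSafelyManipulable (u : ∀ i, D i → X → ℝ) (f : (∀ i, D i) → X) (k : ℕ) : Prop :=
  ∃ (i : ι) (K : Finset ι), i ∉ K ∧ K.card = k ∧
    ∃ (Q : ∀ j, D j) (T P : D i), P ≠ T ∧
      ProfitableGiven u f i T P K Q ∧ SafeGiven u f i T P K Q

open Classical in
/-- The RAT-degree: the least `k` such that `f` is `k`-known-agents safely-manipulable, or the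
number of agents if there is no such `k`. -/
noncomputable def RATDegree (u : ∀ i, D i → X → ℝ) (f : (∀ i, D i) → X) : ℕ :=
  if h : ∃ k, KnownAgentsSafelyManipulable u f k then Nat.find h else Fintype.card ι

end RAT

/-! ### Allocation of indivisible goods -/

/-- A (reported or true) valuation of `m` goods: a nonnegative real number for each good. -/
abbrev GoodsValuation (m : ℕ) : Type := Fin m → ℝ≥0

/-- A valuation profile of `n` agents. -/
abbrev Profile (n m : ℕ) : Type := Fin n → GoodsValuation m

/-- An allocation: each good is given to exactly one agent. -/
abbrev Allocation (n m : ℕ) : Type := Fin m → Fin n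

/-- The bundle that agent `i` receives. -/
def bundle {n m : ℕ} (A : Allocation n m) (i : Fin n) : Finset (Fin m) :=
  Finset.univ.filter fun g => A g = i

/-- The additive extension of a valuation to bundles. -/
noncomputable def bundleValue {m : ℕ} (v : GoodsValuation m) (S : Finset (Fin m)) : ℝ≥0 :=
  ∑ g ∈ S, v g

/-- The utility of agent `i` with valuation `v` from the allocation `A`. -/
noncomputable def goodsUtility (n m : ℕ) (i : Fin n) (v : GoodsValuation m) (A : Allocation n m) : ℝ :=
  (bundleValue v (bundle A i) : ℝ)

/-- Envy-freeness up to one good: for every two agents `i` and `k`, agent `i` weakly prefers her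
own bundle to the bundle of `k` after the removal of at most one good from the latter. -/
def IsEF1 {n m : ℕ} (V : Profile n m) (A : Allocation n m) : Prop :=
  ∀ i k : Fin n, bundleValue (V i) (bundle A k) ≤ bundleValue (V i) (bundle A i) ∨
    ∃ g ∈ bundle A k,
      bundleValue (V i) ((bundle A k).erase g) ≤ bundleValue (V i) (bundle A i)

/-- Agent `k` is not envied by any agent. -/
def IsUnenvied {n m : ℕ} (V : Profile n m) (A : Allocation n m) (k : Fin n) : Prop :=
  ∀ i : Fin n, bundleValue (V i) (bundle A k) ≤ bundleValue (V i) (bundle A i)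

/-- The EF1 allocations in which agent `k` is not envied. -/
def ef1Unenvied {n m : ℕ} (V : Profile n m) (k : Fin n) : Set (Allocation n m) :=
  {A | IsEF1 V A ∧ IsUnenvied V A k}

/-- A priority function: it maps a profile to the pair consisting of the favored agent and the
unfavored agent. -/
abbrev PriorityRule (n m : ℕ) : Type := Profile n m → Fin n × Fin n

/-- Volatility: a change of the report of agent `i` from `v` to `v'` can affect the output in any
possible way, depending on the report `w` of agent `j`, which is positive on a prescribed good
`g` and zero on all other goods. The entries of `V` at `i` and `j` play no role. -/
def IsVolatile {n m : ℕ} (Γ : PriorityRule n m) : Prop :=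
  ∀ (i j p q p' q' : Fin n), i ≠ j → p ≠ q → p' ≠ q' →
    ∀ (g : Fin m) (V : Profile n m) (v v' : GoodsValuation m), v ≠ v' →
      ∃ w : GoodsValuation m, 0 < w g ∧ (∀ h, h ≠ g → w h = 0) ∧
        Γ (Function.update (Function.update V i v) j w) = (p, q) ∧
        Γ (Function.update (Function.update V i v') j w) = (p', q')

/-- `f` is a Volatile Priority goods allocation mechanism with priority function `Γ` (and some
tie-breaking): it outputs, among the EF1 allocations in which the unfavored agent is not envied,
one that maximizes the value of the favored agent for her own bundle. -/
def IsPriorityMechanism {n m : ℕ} (Γ : PriorityRule n m) (f : Profile n m → Allocation n m) :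
    Prop :=
  ∀ V : Profile n m, f V ∈ ef1Unenvied V (Γ V).2 ∧
    ∀ B ∈ ef1Unenvied V (Γ V).2,
      bundleValue (V (Γ V).1) (bundle B (Γ V).1) ≤
        bundleValue (V (Γ V).1) (bundle (f V) (Γ V).1)

/-! ### The priority function that reads the maximum value as a binary code -/

/-- The largest value reported by any agent for any good. -/
noncomputable def maxValue {n m : ℕ} (V : Profile n m) : ℝ≥0 :=
  Finset.univ.sup fun a : Fin n × Fin m => V a.1 a.2

/-- The binary digit of the nonnegative real `x` at the position of weight `2 ^ t`. -/
noncomputable def binaryDigit (x : ℝ≥0) (t : ℤ) : ℕ := ⌊x / (2 : ℝ≥0) ^ t⌋₊ % 2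

/-- The number with binary digits `start, …, start + width - 1` (counted from the least significant
digit `0`) of `N`; missing most significant digits of `N` count as `0`. -/
def bitField (N start width : ℕ) : ℕ := N / 2 ^ start % 2 ^ width

/-- The information carried by a code: an agent, a good, the position of a binary digit, and two
natural numbers. -/
structure PriorityCode (n m : ℕ) where
  agent : Fin n
  good : Fin m
  pos : ℤ
  a : ℕ
  b : ℕ

/-- Decoding of a binary string. Reading from the least significant digit, it consists of `L`
digits `1` and one digit `0` (which announce the length `L` of the next block), `L` digits for the
absolute value of the position, one digit for its sign, and four blocks of fixed length for the
agent, the good, `a` and `b`. All further digits are ignored. -/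
def decodePriority {n m : ℕ} (hn : 2 ≤ n) (hm : 1 ≤ m) (N : ℕ) : PriorityCode n m :=
  let L := padicValNat 2 (N + 1)
  let s := 2 * L + 2
  let wn := Nat.size n
  let wm := Nat.size m
  let wp := Nat.size (n * (n - 1))
  { agent := ⟨bitField N s wn % n, Nat.mod_lt _ (by omega)⟩
    good := ⟨bitField N (s + wn) wm % m, Nat.mod_lt _ (by omega)⟩
    pos := if bitField N (2 * L + 1) 1 = 0 then (bitField N (L + 1) L : ℤ)
      else -(bitField N (L + 1) L : ℤ)
    a := bitField N (s + wn + wm) wp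
    b := bitField N (s + wn + wm + wp) wp }

/-- The enumeration of the `n * (n - 1)` ordered pairs of different agents by the numbers
`0, …, n * (n - 1) - 1`: the first agent is `p / (n - 1)`, the second one follows it cyclically
at distance `1 + p % (n - 1)`. -/
def agentPair {n : ℕ} (hn : 2 ≤ n) (p : ℕ) : Fin n × Fin n :=
  (⟨p / (n - 1) % n, Nat.mod_lt _ (by omega)⟩,
    ⟨(p / (n - 1) + 1 + p % (n - 1)) % n, Nat.mod_lt _ (by omega)⟩)

/-- The priority function that decodes (the integer part of) the maximum reported value into an
agent `i`, a good `ℓ`, a position `t` and numbers `a`, `b`, reads the digit `s` at position `t` of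
the value of agent `i` for the good `ℓ`, and outputs the ordered pair of different agents with
number `(a * s + b) mod (n * (n - 1))`. -/
noncomputable def binaryPriority {n m : ℕ} (hn : 2 ≤ n) (hm : 1 ≤ m) : PriorityRule n m :=
  fun V =>
    let c := decodePriority (m := m) hn hm ⌊maxValue V⌋₊
    agentPair hn ((c.a * binaryDigit (V c.agent c.good) c.pos + c.b) % (n * (n - 1)))

/-!
The binary priority function is volatile because the report of agent `j` on the single good `g` can
be chosen as an integer above all other reports, so that its binary expansion is the code that is
read. Two different valuations of `i` differ in some binary digit of the value of some good
(`exists_binaryDigit_ne`), and an affine function of that digit takes any two prescribed values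
modulo `n * (n - 1)`. Every code occurs in arbitrarily large integers (`exists_decodePriority`).

A mechanism exists because round robin with `k` picking last is EF1 and leaves `k` unenvied
(`exists_roundRobin`).

With `n - 1` known agents, `i` can profit: if the others value nothing, except for one good of `j`,
then a change of the report can turn `j` being favored, and receiving that good, into `i` being
favored and receiving everything (`knownAgentsSafelyManipulable_sub_one`).

With fewer known agents some `j ≠ i` is unknown. Let `T` be the true valuation of `i`, let `P` be
another report, and let `g` be a good with `T g > 0`. Volatility yields a report of `j`, positive
only on `g`, such that under `T` agent `i` is favored and `j` unfavored, and under `P` the other way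
round. Under `P` agent `j` receives `g` and nobody envies `i`, in an allocation `B`. It remains to
find an allocation that is EF1 with respect to `T`, leaves `j` unenvied, and gives `i` at least
`T (B i) + T g` (`exists_mem_ef1Unenvied_ge`); then the truth is strictly better. Move `g` to `i`,
and take everything else from `j`, who still has no envy beyond one good. The remaining agents other
than `i` accept their bundles up to one good, but `i` may not, as `B` is EF1 with respect to `P`
only.

This is repaired by the following procedure (`exists_isPartialEF1_of_forall_ne`). Exactly one agent
`s` may not accept her bundle `X`, where at first `X` is the bundle of `i` and `X` never changes. If
`s` does not accept `X`, she chooses a bundle with maximal value after the removal of its best good,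
discards that good and takes the rest, which she accepts by maximality and values more than `X`. The
previous owner receives `X` and takes over the role of `s`. Everybody else still accepts her bundle,
because bundles have only shrunk. The number of goods drops, so the procedure ends, and `i` never
holds anything worth less than `X` to her. Finally, the discarded goods are distributed by the
envy-cycle argument without harming anybody (`IsPartialEF1.exists_complete`).
-/

/-! ### Binary digits determine a nonnegative real -/

lemma floor_div_zpow_succ (x : ℝ≥0) (t : ℤ) :
    ⌊x / (2 : ℝ≥0) ^ t⌋₊ = 2 * ⌊x / (2 : ℝ≥0) ^ (t + 1)⌋₊ + binaryDigit x t := by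
  have h : ⌊x / (2 : ℝ≥0) ^ (t + 1)⌋₊ = ⌊x / (2 : ℝ≥0) ^ t⌋₊ / 2 := by
    rw [← Nat.floor_div_ofNat, zpow_add₀ two_ne_zero, zpow_one, div_div]
  rw [h, binaryDigit, Nat.div_add_mod]

lemma exists_binaryDigit_ne {x y : ℝ≥0} (hxy : x ≠ y) :
    ∃ t : ℤ, binaryDigit x t ≠ binaryDigit y t := by
  by_contra! hd
  obtain ⟨k, hk⟩ := pow_unbounded_of_one_lt (max x y) (one_lt_two (α := ℝ≥0))
  -- Above position `k` all digits vanish; going down, equal digits keep the truncations equal.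
  have key : ∀ d : ℕ, ⌊x / (2 : ℝ≥0) ^ ((k : ℤ) - d)⌋₊ = ⌊y / (2 : ℝ≥0) ^ ((k : ℤ) - d)⌋₊ := by
    intro d
    induction d with
    | zero =>
      have h0 : ∀ z : ℝ≥0, z ≤ max x y → ⌊z / (2 : ℝ≥0) ^ ((k : ℤ) - (0 : ℕ))⌋₊ = 0 := by
        intro z hz
        rw [Nat.floor_eq_zero]
        simpa using (div_lt_one (by positivity)).2 (hz.trans_lt hk)
      rw [h0 x (le_max_left _ _), h0 y (le_max_right _ _)]
    | succ d ih =>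
      have e : (k : ℤ) - ((d + 1 : ℕ) : ℤ) + 1 = (k : ℤ) - d := by push_cast; ring
      rw [floor_div_zpow_succ x, floor_div_zpow_succ y, e, ih, hd]
  wlog hlt : x < y generalizing x y
  · exact this hxy.symm (fun t => (hd t).symm) (by rwa [max_comm]) (fun d => (key d).symm)
      (lt_of_le_of_ne (not_lt.1 hlt) hxy.symm)
  have hpos : 0 < y - x := tsub_pos_of_lt hlt
  -- At a position of weight at most `y - x` the truncations differ by at least one.
  obtain ⟨d, hdd⟩ := pow_unbounded_of_one_lt ((2 : ℝ≥0) ^ k / (y - x)) (one_lt_two (α := ℝ≥0))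
  set w : ℝ≥0 := (2 : ℝ≥0) ^ ((k : ℤ) - d) with hw
  have hwpos : 0 < w := by positivity
  have hwlt : w ≤ y - x := by
    rw [hw, zpow_sub₀ two_ne_zero, zpow_natCast, zpow_natCast]
    rw [div_lt_iff₀ hpos] at hdd
    rw [div_le_iff₀ (by positivity), mul_comm]
    exact hdd.le
  have h1 : x / w + 1 ≤ y / w := by
    rw [← div_self hwpos.ne', ← add_div]
    gcongr
    calc x + w ≤ x + (y - x) := by gcongr
      _ = y := add_tsub_cancel_of_le hlt.le
  have h2 : ⌊x / w⌋₊ + 1 ≤ ⌊y / w⌋₊ := by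
    rw [← Nat.floor_add_one zero_le]
    exact Nat.floor_mono h1
  have h3 := key d
  rw [← hw] at h3
  omega

/-! ### Codes with prescribed content -/

lemma bitField_shift (x N k s w : ℕ) (hx : x < 2 ^ k) :
    bitField (x + 2 ^ k * N) (k + s) w = bitField N s w := by
  unfold bitField
  rw [pow_add, ← Nat.div_div_eq_div_mul, Nat.add_mul_div_left _ _ (by positivity),
    Nat.div_eq_of_lt hx, zero_add]

lemma bitField_head (x N w : ℕ) (hx : x < 2 ^ w) : bitField (x + 2 ^ w * N) 0 w = x := by
  simp [bitField, Nat.add_mul_mod_self_left, Nat.mod_eq_of_lt hx]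

/-- Every code is carried by arbitrarily large numbers, because the digits behind the last block
are free. -/
lemma exists_decodePriority {n m : ℕ} (hn : 2 ≤ n) (hm : 1 ≤ m) (i : Fin n) (l : Fin m) (t : ℤ)
    {a b : ℕ} (ha : a < n * (n - 1)) (hb : b < n * (n - 1)) (M : ℕ) :
    ∃ N, M ≤ N ∧ decodePriority hn hm N = ⟨i, l, t, a, b⟩ := by
  set L := t.natAbs with hL
  have ht : t.natAbs < 2 ^ L := Nat.lt_two_pow_self
  set wn := Nat.size n
  set wm := Nat.size m
  set wp := Nat.size (n * (n - 1))
  have hi : (i : ℕ) < 2 ^ wn := i.2.trans (Nat.lt_size_self n)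
  have hl : (l : ℕ) < 2 ^ wm := l.2.trans (Nat.lt_size_self m)
  have ha' : a < 2 ^ wp := ha.trans (Nat.lt_size_self _)
  have hb' : b < 2 ^ wp := hb.trans (Nat.lt_size_self _)
  obtain ⟨sg, hsg, hsgn⟩ : ∃ sg : ℕ, sg < 2 ^ 1 ∧
      (if sg = 0 then (t.natAbs : ℤ) else -(t.natAbs : ℤ)) = t := by
    rcases le_total 0 t with h | h
    · exact ⟨0, by norm_num, by simp [abs_of_nonneg h]⟩
    · exact ⟨1, by norm_num, by simp [abs_of_nonpos h]⟩
  set N5 := b + 2 ^ wp * M with hN5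
  set N4 := a + 2 ^ wp * N5 with hN4
  set N3 := (l : ℕ) + 2 ^ wm * N4 with hN3
  set N2 := (i : ℕ) + 2 ^ wn * N3 with hN2
  set N1 := sg + 2 ^ 1 * N2 with hN1
  set N0 := t.natAbs + 2 ^ L * N1 with hN0
  set N := (2 ^ L - 1) + 2 ^ (L + 1) * N0 with hN
  have hLpos : 0 < 2 ^ L := by positivity
  have hpre : 2 ^ L - 1 < 2 ^ (L + 1) := by rw [pow_succ]; omega
  have hval : padicValNat 2 (N + 1) = L := by
    have e : N + 1 = 2 ^ L * (1 + 2 * N0) := by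
      have : 2 ^ L - 1 + 1 = 2 ^ L := Nat.sub_add_cancel hLpos
      calc N + 1 = (2 ^ L - 1 + 1) + 2 ^ (L + 1) * N0 := by rw [hN]; ring
        _ = _ := by rw [this]; ring
    rw [e, padicValNat.mul (by positivity) (by omega), padicValNat.prime_pow,
      padicValNat.eq_zero_of_not_dvd (by omega), add_zero]
  have f0 : ∀ s w, bitField N (L + 1 + s) w = bitField N0 s w :=
    fun s w => bitField_shift _ _ _ _ _ hpre
  have f1 : ∀ s w, bitField N (2 * L + 1 + s) w = bitField N1 s w := by
    intro s w
    rw [show 2 * L + 1 + s = L + 1 + (L + s) by ring, f0]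
    exact bitField_shift _ _ _ _ _ ht
  have f2 : ∀ s w, bitField N (2 * L + 2 + s) w = bitField N2 s w := by
    intro s w
    rw [show 2 * L + 2 + s = 2 * L + 1 + (1 + s) by ring, f1]
    exact bitField_shift _ _ _ _ _ hsg
  have f3 : ∀ s w, bitField N (2 * L + 2 + wn + s) w = bitField N3 s w := by
    intro s w
    rw [add_assoc, f2]
    exact bitField_shift _ _ _ _ _ hi
  have f4 : ∀ s w, bitField N (2 * L + 2 + wn + wm + s) w = bitField N4 s w := by
    intro s w
    rw [add_assoc, f3]
    exact bitField_shift _ _ _ _ _ hl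
  have f5 : ∀ s w, bitField N (2 * L + 2 + wn + wm + wp + s) w = bitField N5 s w := by
    intro s w
    rw [add_assoc, f4]
    exact bitField_shift _ _ _ _ _ ha'
  have g0 : bitField N (L + 1) L = t.natAbs := (f0 0 L).trans (bitField_head _ _ _ ht)
  have g1 : bitField N (2 * L + 1) 1 = sg := (f1 0 1).trans (bitField_head _ _ _ hsg)
  have g2 : bitField N (2 * L + 2) wn = i := (f2 0 _).trans (bitField_head _ _ _ hi)
  have g3 : bitField N (2 * L + 2 + wn) wm = l := (f3 0 _).trans (bitField_head _ _ _ hl)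
  have g4 : bitField N (2 * L + 2 + wn + wm) wp = a := (f4 0 _).trans (bitField_head _ _ _ ha')
  have g5 : bitField N (2 * L + 2 + wn + wm + wp) wp = b :=
    (f5 0 _).trans (bitField_head _ _ _ hb')
  refine ⟨N, ?_, ?_⟩
  · have step : ∀ x k y : ℕ, y ≤ x + 2 ^ k * y := fun x k y =>
      (Nat.le_mul_of_pos_left y (by positivity)).trans (Nat.le_add_left _ _)
    exact (step _ _ _).trans <| (step _ _ _).trans <| (step _ _ _).trans <|
      (step _ _ _).trans <| (step _ _ _).trans <| (step _ _ _).trans (step _ _ _)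
  · unfold decodePriority
    simp only [hval]
    rw [PriorityCode.mk.injEq]
    refine ⟨Fin.ext ?_, Fin.ext ?_, ?_, g4, g5⟩
    · exact (congrArg (· % n) g2).trans (Nat.mod_eq_of_lt i.2)
    · exact (congrArg (· % m) g3).trans (Nat.mod_eq_of_lt l.2)
    · rw [g1, g0]; exact hsgn

/-! ### Volatility of the binary priority function -/

lemma agentPair_fst_ne_snd {n : ℕ} (hn : 2 ≤ n) {p : ℕ} (hp : p < n * (n - 1)) :
    (agentPair hn p).1 ≠ (agentPair hn p).2 := by
  have hx : p / (n - 1) < n := Nat.div_lt_of_lt_mul (by rwa [mul_comm])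
  have hr : p % (n - 1) < n - 1 := Nat.mod_lt _ (by omega)
  intro h
  have h' : p / (n - 1) % n = (p / (n - 1) + 1 + p % (n - 1)) % n := congrArg Fin.val h
  rw [Nat.mod_eq_of_lt hx] at h'
  generalize p / (n - 1) = x at *
  generalize p % (n - 1) = r at *
  rcases lt_or_ge (x + 1 + r) n with h1 | h1
  · rw [Nat.mod_eq_of_lt h1] at h'; omega
  · rw [Nat.mod_eq_sub_mod h1, Nat.mod_eq_of_lt (by omega)] at h'; omega

lemma exists_agentPair_eq {n : ℕ} (hn : 2 ≤ n) {x y : Fin n} (hxy : x ≠ y) :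
    ∃ p < n * (n - 1), agentPair hn p = (x, y) := by
  have hne : (x : ℕ) ≠ y := fun h => hxy (Fin.ext h)
  have hx := x.2
  have hy := y.2
  -- `r + 1` is the cyclic distance from `x` to `y`.
  obtain ⟨r, hr, hmod⟩ : ∃ r < n - 1, ((x : ℕ) + 1 + r) % n = y := by
    rcases lt_or_gt_of_ne hne with h | h
    · refine ⟨y - x - 1, by omega, ?_⟩
      rw [show (x : ℕ) + 1 + (y - x - 1) = y by omega, Nat.mod_eq_of_lt hy]
    · refine ⟨n + y - x - 1, by omega, ?_⟩
      rw [show (x : ℕ) + 1 + (n + y - x - 1) = y + n by omega, Nat.add_mod_right,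
        Nat.mod_eq_of_lt hy]
  have hdiv : ((n - 1) * (x : ℕ) + r) / (n - 1) = x := by
    rw [Nat.mul_add_div (by omega), Nat.div_eq_of_lt hr, add_zero]
  have hrem : ((n - 1) * (x : ℕ) + r) % (n - 1) = r := by
    rw [Nat.mul_add_mod, Nat.mod_eq_of_lt hr]
  refine ⟨(n - 1) * x + r, ?_, ?_⟩
  · calc (n - 1) * (x : ℕ) + r < (n - 1) * x + (n - 1) := by omega
      _ = (n - 1) * (x + 1) := by ring
      _ ≤ (n - 1) * n := Nat.mul_le_mul_left _ hx
      _ = n * (n - 1) := mul_comm _ _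
  · unfold agentPair
    simp only [hdiv, hrem, hmod, Nat.mod_eq_of_lt hx]

/-- An affine function of a binary digit modulo `M` can take any two prescribed values at two
different digits. -/
lemma exists_affine_mod {M x y s s' : ℕ} (hx : x < M) (hy : y < M) (hs : s < 2) (hs' : s' < 2)
    (hne : s ≠ s') : ∃ a < M, ∃ b < M, (a * s + b) % M = x ∧ (a * s' + b) % M = y := by
  have main : ∀ u w : ℕ, u < M → w < M → ∃ a < M, (a + u) % M = w := by
    intro u w hu hw
    refine ⟨(w + (M - u)) % M, Nat.mod_lt _ (by omega), ?_⟩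
    rw [Nat.mod_add_mod, show w + (M - u) + u = w + M by omega, Nat.add_mod_right,
      Nat.mod_eq_of_lt hw]
  interval_cases s <;> interval_cases s'
  · exact absurd rfl hne
  · obtain ⟨a, ha, h⟩ := main x y hx hy
    exact ⟨a, ha, x, hx, by simpa using Nat.mod_eq_of_lt hx, by simpa using h⟩
  · obtain ⟨a, ha, h⟩ := main y x hy hx
    exact ⟨a, ha, y, hy, by simpa using h, by simpa using Nat.mod_eq_of_lt hy⟩
  · exact absurd rfl hne

lemma isVolatile_binaryPriority {n m : ℕ} (hn : 2 ≤ n) (hm : 1 ≤ m) :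
    IsVolatile (binaryPriority (m := m) hn hm) := by
  intro i j p q p' q' hij hpq hpq' g V v v' hv
  obtain ⟨l, hl⟩ := Function.ne_iff.1 hv
  obtain ⟨t, ht⟩ := exists_binaryDigit_ne hl
  obtain ⟨x, hx, hxe⟩ := exists_agentPair_eq hn hpq
  obtain ⟨y, hy, hye⟩ := exists_agentPair_eq hn hpq'
  obtain ⟨a, ha, b, hb, h1, h2⟩ := exists_affine_mod hx hy
    (s := binaryDigit (v l) t) (s' := binaryDigit (v' l) t)
    (Nat.mod_lt _ two_pos) (Nat.mod_lt _ two_pos) ht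
  -- Agent `j` reports a number that carries the code and exceeds all other reports.
  obtain ⟨N, hN, hdec⟩ := exists_decodePriority hn hm i l t ha hb
    (⌈maxValue (Function.update V i v) ⊔ maxValue (Function.update V i v')⌉₊ + 1)
  set w : GoodsValuation m := Pi.single g (N : ℝ≥0) with hw
  have hmax : ∀ u : GoodsValuation m, maxValue (Function.update V i u) ≤ N →
      maxValue (Function.update (Function.update V i u) j w) = N := by
    intro u hu
    apply le_antisymm
    · refine Finset.sup_le fun c _ => ?_
      rcases eq_or_ne c.1 j with hc | hc
      · rw [hc, Function.update_self, hw]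
        rcases eq_or_ne c.2 g with hg | hg
        · rw [hg, Pi.single_eq_same]
        · rw [Pi.single_eq_of_ne hg]; exact zero_le
      · rw [Function.update_of_ne hc]
        exact le_trans (Finset.le_sup
          (f := fun c : Fin n × Fin m => Function.update V i u c.1 c.2) (Finset.mem_univ c)) hu
    · have := Finset.le_sup (f := fun c : Fin n × Fin m =>
        Function.update (Function.update V i u) j w c.1 c.2) (Finset.mem_univ (j, g))
      simpa [hw, maxValue] using this
  have hNle : maxValue (Function.update V i v) ⊔ maxValue (Function.update V i v') ≤ N :=
    (Nat.le_ceil _).trans (by exact_mod_cast (Nat.le_succ _).trans hN)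
  have hout : ∀ u : GoodsValuation m, maxValue (Function.update V i u) ≤ N →
      binaryPriority hn hm (Function.update (Function.update V i u) j w) =
        agentPair hn ((a * binaryDigit (u l) t + b) % (n * (n - 1))) := by
    intro u hu
    simp only [binaryPriority, hmax u hu, Nat.floor_natCast, hdec]
    rw [Function.update_of_ne hij, Function.update_self]
  refine ⟨w, ?_, fun h hh => Pi.single_eq_of_ne hh _, ?_, ?_⟩
  · rw [hw, Pi.single_eq_same]
    exact_mod_cast (Nat.succ_pos _).trans_le hN
  · rw [hout v (le_sup_left.trans hNle), h1, hxe]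
  · rw [hout v' (le_sup_right.trans hNle), h2, hye]

lemma binaryPriority_fst_ne_snd {n m : ℕ} (hn : 2 ≤ n) (hm : 1 ≤ m) (V : Profile n m) :
    (binaryPriority hn hm V).1 ≠ (binaryPriority hn hm V).2 :=
  agentPair_fst_ne_snd hn (Nat.mod_lt _ (Nat.mul_pos (by omega) (by omega)))

/-! ### Bundles and envy up to one good -/

/-- The bundle `S` is worth at most `x` after the removal of at most one good. Thus `IsEF1 V A`
says that, for every agent `i`, every bundle of `A` is worth at most the value of the own bundle
in this sense. -/
def WorthAtMostUpToOne {m : ℕ} (v : GoodsValuation m) (S : Finset (Fin m)) (x : ℝ≥0) : Prop :=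
  bundleValue v S ≤ x ∨ ∃ g ∈ S, bundleValue v (S.erase g) ≤ x

lemma bundleValue_mono {m : ℕ} (v : GoodsValuation m) {S S' : Finset (Fin m)} (h : S ⊆ S') :
    bundleValue v S ≤ bundleValue v S' :=
  Finset.sum_le_sum_of_subset h

lemma le_bundleValue {m : ℕ} (v : GoodsValuation m) {S : Finset (Fin m)} {g : Fin m} (h : g ∈ S) :
    v g ≤ bundleValue v S :=
  Finset.single_le_sum (fun _ _ => zero_le) h

lemma bundleValue_le_of_injOn {m : ℕ} (v : GoodsValuation m) {S S' : Finset (Fin m)}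
    (φ : Fin m → Fin m) (hmaps : ∀ g ∈ S, φ g ∈ S') (hinj : Set.InjOn φ S)
    (hle : ∀ g ∈ S, v g ≤ v (φ g)) : bundleValue v S ≤ bundleValue v S' :=
  calc bundleValue v S ≤ ∑ g ∈ S, v (φ g) := Finset.sum_le_sum hle
    _ = ∑ g ∈ S.image φ, v g := (Finset.sum_image hinj).symm
    _ ≤ bundleValue v S' := bundleValue_mono v (Finset.image_subset_iff.2 hmaps)

lemma WorthAtMostUpToOne.mono {m : ℕ} {v : GoodsValuation m} {S S' : Finset (Fin m)} {x x' : ℝ≥0}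
    (h : WorthAtMostUpToOne v S x) (hS : S' ⊆ S) (hx : x ≤ x') : WorthAtMostUpToOne v S' x' := by
  rcases h with h | ⟨g, _, hg⟩
  · exact Or.inl ((bundleValue_mono v hS).trans (h.trans hx))
  · by_cases hgS : g ∈ S'
    · exact Or.inr ⟨g, hgS, (bundleValue_mono v (Finset.erase_subset_erase g hS)).trans (hg.trans hx)⟩
    · refine Or.inl ((bundleValue_mono v ?_).trans (hg.trans hx))
      exact Finset.subset_erase.2 ⟨hS, hgS⟩

/-- The bundle `t` is `S` without a good of largest value. -/
lemma exists_worthAtMostUpToOne_iff {m : ℕ} (v : GoodsValuation m) (S : Finset (Fin m)) :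
    ∃ t ⊆ S, (S.Nonempty → t.card < S.card) ∧
      ∀ x, WorthAtMostUpToOne v S x ↔ bundleValue v t ≤ x := by
  rcases S.eq_empty_or_nonempty with rfl | hS
  · exact ⟨∅, subset_rfl, fun h => absurd h Finset.not_nonempty_empty, fun x => by
      simp [WorthAtMostUpToOne]⟩
  · obtain ⟨g, hg, hmin⟩ := S.exists_min_image (fun g => bundleValue v (S.erase g)) hS
    refine ⟨S.erase g, Finset.erase_subset _ _, fun _ => Finset.card_erase_lt_of_mem hg,
      fun x => ⟨?_, fun h => Or.inr ⟨g, hg, h⟩⟩⟩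
    rintro (h | ⟨g', hg', h⟩)
    · exact (bundleValue_mono v (Finset.erase_subset _ _)).trans h
    · exact (hmin g' hg').trans h

/-! ### Round robin -/

/-- The good `p τ` is the one picked at time `τ`, if each pick has the largest value for `v τ` among
the goods that are left. -/
lemma exists_picking_order {m : ℕ} (v : ℕ → Fin m → ℝ≥0) :
    ∃ p : Equiv.Perm (Fin m), ∀ τ σ : Fin m, τ ≤ σ → v τ (p σ) ≤ v τ (p τ) := by
  suffices h : ∃ p : Fin m → Fin m, Function.Injective p ∧
      ∀ τ σ : Fin m, τ ≤ σ → v τ (p σ) ≤ v τ (p τ) by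
    obtain ⟨p, hp, h⟩ := h
    exact ⟨Equiv.ofBijective p (Finite.injective_iff_bijective.1 hp), h⟩
  induction m with
  | zero => exact ⟨id, Function.injective_id, fun τ => τ.elim0⟩
  | succ m ih =>
    obtain ⟨x, hx⟩ := Finite.exists_max (v 0)
    obtain ⟨p, hp, h⟩ := ih fun τ y => v (τ + 1) (x.succAbove y)
    refine ⟨Fin.cons x fun t => x.succAbove (p t), ?_, ?_⟩
    · rw [Fin.cons_injective_iff]
      refine ⟨?_, Fin.succAbove_right_injective.comp hp⟩
      rintro ⟨t, ht⟩
      exact Fin.succAbove_ne x _ ht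
    · intro τ σ hτσ
      induction τ using Fin.cases with
      | zero => exact hx _
      | succ τ =>
        induction σ using Fin.cases with
        | zero => exact absurd hτσ (by simp)
        | succ σ => simpa using h τ σ (by simpa using hτσ)

/-- Round robin in the order given by `r`: nobody envies an agent who picks later, and an agent
who picks earlier is not envied any more once her first good is removed. -/
lemma exists_roundRobin {n m : ℕ} (hn : 0 < n) (V : Profile n m) (r : Equiv.Perm (Fin n)) :
    ∃ A : Allocation n m, IsEF1 V A ∧
      (∀ a b, r a ≤ r b → bundleValue (V a) (bundle A b) ≤ bundleValue (V a) (bundle A a)) ∧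
      ∀ a, (r a : ℕ) = 0 → ∀ g, V a g ≤ bundleValue (V a) (bundle A a) := by
  set picker : ℕ → Fin n := fun τ => r.symm ⟨τ % n, Nat.mod_lt _ hn⟩ with hpicker
  obtain ⟨e, he⟩ := exists_picking_order fun τ => V (picker τ)
  set A : Allocation n m := fun g => picker (e.symm g) with hA
  have hmem : ∀ a g, g ∈ bundle A a ↔ (e.symm g : ℕ) % n = r a := by
    intro a g
    simp only [bundle, hA, hpicker, Finset.mem_filter, Finset.mem_univ, true_and]
    rw [Equiv.symm_apply_eq, Fin.ext_iff]
  -- Shifting the picks in `S` by `d` steps back in time turns them into better picks of `a`.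
  have shift : ∀ (a : Fin n) (S : Finset (Fin m)) (d : ℕ),
      (∀ g ∈ S, d ≤ (e.symm g : ℕ) ∧ ((e.symm g : ℕ) - d) % n = r a) →
      bundleValue (V a) S ≤ bundleValue (V a) (bundle A a) := by
    intro a S d hS
    refine bundleValue_le_of_injOn _
      (fun g => e ⟨(e.symm g : ℕ) - d, (Nat.sub_le _ _).trans_lt (e.symm g).2⟩) ?_ ?_ ?_
    · intro g hg
      rw [hmem, Equiv.symm_apply_apply]
      exact (hS g hg).2
    · intro g hg g' hg' h
      have h1 := congrArg Fin.val (e.injective h)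
      have h2 := (hS g hg).1
      have h3 := (hS g' hg').1
      simp only at h1
      exact e.symm.injective (Fin.ext (by omega))
    · intro g hg
      have h := he ⟨(e.symm g : ℕ) - d, (Nat.sub_le _ _).trans_lt (e.symm g).2⟩ (e.symm g)
        (Fin.le_def.2 (Nat.sub_le _ _))
      have hp : picker ((e.symm g : ℕ) - d) = a := by
        rw [hpicker]
        simp only [(hS g hg).2, Fin.eta, Equiv.symm_apply_apply]
      simpa only [hp, Equiv.apply_symm_apply] using h
  have hle : ∀ a b, r a ≤ r b →
      bundleValue (V a) (bundle A b) ≤ bundleValue (V a) (bundle A a) := by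
    intro a b hab
    rw [Fin.le_def] at hab
    refine shift a _ (r b - r a) fun g hg => ?_
    rw [hmem] at hg
    have h1 := Nat.div_add_mod (e.symm g : ℕ) n
    rw [hg] at h1
    refine ⟨by omega, ?_⟩
    rw [show (e.symm g : ℕ) - (r b - r a) = n * ((e.symm g : ℕ) / n) + r a by omega,
      Nat.mul_add_mod, Nat.mod_eq_of_lt (r a).2]
  refine ⟨A, fun a b => ?_, hle, ?_⟩
  · rcases le_or_gt (r a) (r b) with hab | hab
    · exact Or.inl (hle a b hab)
    · rw [Fin.lt_def] at hab
      have hra := (r a).2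
      by_cases hb : (r b : ℕ) < m
      · refine Or.inr ⟨e ⟨r b, hb⟩, ?_, shift a _ (r b + n - r a) fun g hg => ?_⟩
        · rw [hmem, Equiv.symm_apply_apply]
          exact Nat.mod_eq_of_lt (r b).2
        · rw [Finset.mem_erase, hmem] at hg
          have h1 := Nat.div_add_mod (e.symm g : ℕ) n
          rw [hg.2] at h1
          obtain ⟨q, hq⟩ : ∃ q, (e.symm g : ℕ) / n = q + 1 := by
            refine Nat.exists_eq_succ_of_ne_zero fun h0 => hg.1 ?_
            rw [h0, mul_zero, zero_add] at h1
            rw [← Equiv.symm_apply_eq]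
            exact Fin.ext h1.symm
          rw [hq, mul_add, mul_one] at h1
          refine ⟨by omega, ?_⟩
          rw [show (e.symm g : ℕ) - (r b + n - r a) = n * q + r a by omega,
            Nat.mul_add_mod, Nat.mod_eq_of_lt hra]
      · have : bundle A b = ∅ := by
          refine Finset.eq_empty_of_forall_notMem fun g hg => hb ?_
          rw [hmem] at hg
          exact hg ▸ (Nat.mod_le _ _).trans_lt (e.symm g).2
        exact Or.inl (by simp [this, bundleValue])
  · intro a ha g
    have hm : 0 < m := g.pos
    have h := he ⟨0, hm⟩ (e.symm g) (Fin.le_def.2 (Nat.zero_le _))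
    have hp : picker 0 = a := by
      rw [hpicker, Equiv.symm_apply_eq]
      exact Fin.ext (by simp [ha])
    simp only [hp, Equiv.apply_symm_apply] at h
    refine h.trans (le_bundleValue _ ?_)
    rw [hmem, Equiv.symm_apply_apply, ha]
    exact Nat.zero_mod n

lemma nonempty_ef1Unenvied {n m : ℕ} (V : Profile n m) (k : Fin n) :
    (ef1Unenvied V k).Nonempty := by
  have hn := k.pos
  obtain ⟨A, hA, hle, -⟩ := exists_roundRobin hn V (Equiv.swap k ⟨n - 1, by omega⟩)
  refine ⟨A, hA, fun a => hle a k ?_⟩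
  rw [Equiv.swap_apply_left, Fin.le_def]
  exact Nat.le_sub_one_of_lt (Fin.is_lt _)

/-- The witness is round robin with `j` first and `i` last. -/
lemma exists_mem_ef1Unenvied_best {n m : ℕ} (V : Profile n m) {i j : Fin n} (hij : i ≠ j) :
    ∃ A ∈ ef1Unenvied V i, ∀ g, V j g ≤ bundleValue (V j) (bundle A j) := by
  have hn : 1 < n := by
    have := Fin.val_ne_of_ne hij
    omega
  set z : Fin n := ⟨0, by omega⟩
  set l : Fin n := ⟨n - 1, by omega⟩
  have hzl : z ≠ l := Fin.ne_of_val_ne (by simp only [z, l]; omega)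
  set r : Equiv.Perm (Fin n) := Equiv.swap (Equiv.swap j z i) l * Equiv.swap j z
  have hz : Equiv.swap j z i ≠ z := by
    intro h
    rw [Equiv.swap_apply_eq_iff, Equiv.swap_apply_right] at h
    exact hij h
  have hri : r i = l := by simp [r]
  have hrj : r j = z := by
    simp only [r, Equiv.Perm.mul_apply, Equiv.swap_apply_left]
    exact Equiv.swap_apply_of_ne_of_ne hz.symm hzl
  obtain ⟨A, hA, hle, hbest⟩ := exists_roundRobin (by omega) V r
  refine ⟨A, ⟨hA, fun a => hle a i ?_⟩, hbest j (by rw [hrj])⟩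
  rw [hri, Fin.le_def]
  exact Nat.le_sub_one_of_lt (Fin.is_lt _)

lemma exists_isPriorityMechanism {n m : ℕ} (Γ : PriorityRule n m) :
    ∃ f : Profile n m → Allocation n m, IsPriorityMechanism Γ f := by
  choose f hf hmax using fun V : Profile n m =>
    Set.exists_max_image (ef1Unenvied V (Γ V).2)
      (fun A => bundleValue (V (Γ V).1) (bundle A (Γ V).1)) (Set.toFinite _)
      (nonempty_ef1Unenvied V _)
  exact ⟨f, fun V => ⟨hf V, hmax V⟩⟩

/-! ### Partial allocations -/

/-- A partial allocation among the agents of `α`: pairwise disjoint bundles, such that every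
agent values every bundle, up to one good, at most as much as her own one. -/
def IsPartialEF1 {α : Type} {m : ℕ} (U : α → GoodsValuation m) (A : α → Finset (Fin m)) : Prop :=
  Pairwise (fun a b => Disjoint (A a) (A b)) ∧
    ∀ a b, WorthAtMostUpToOne (U a) (A b) (bundleValue (U a) (A a))

/-- If everybody except `s` accepts her bundle, then goods can be discarded and bundles exchanged
such that everybody accepts hers and the value of `i` does not fall below `c`. The agent `s`, if
she does not accept her bundle, discards a good from the bundle with the largest value after the
removal of a good, takes the rest and leaves her own bundle to the previous owner, who is now the
only agent that may not accept her bundle. -/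
lemma exists_isPartialEF1_of_forall_ne {α : Type} [Fintype α] [DecidableEq α] {m : ℕ}
    (U : α → GoodsValuation m) (i : α) (c : ℝ≥0) (A : α → Finset (Fin m)) (s : α)
    (hdisj : Pairwise (fun a b => Disjoint (A a) (A b)))
    (hEF : ∀ a, a ≠ s → ∀ b, WorthAtMostUpToOne (U a) (A b) (bundleValue (U a) (A a)))
    (hs : c ≤ bundleValue (U i) (A s)) (hi : c ≤ bundleValue (U i) (A i)) :
    ∃ A', IsPartialEF1 U A' ∧ c ≤ bundleValue (U i) (A' i) := by
  induction hN : ∑ a, (A a).card using Nat.strong_induction_on generalizing A s with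
  | _ N ih =>
  subst hN
  by_cases hacc : ∀ b, WorthAtMostUpToOne (U s) (A b) (bundleValue (U s) (A s))
  · refine ⟨A, ⟨hdisj, fun a b => ?_⟩, hi⟩
    rcases eq_or_ne a s with rfl | ha
    · exact hacc b
    · exact hEF a ha b
  push Not at hacc
  obtain ⟨b₀, hb₀⟩ := hacc
  choose t htsub htcard ht using fun b => exists_worthAtMostUpToOne_iff (U s) (A b)
  have : Nonempty α := ⟨s⟩
  obtain ⟨b, hb⟩ := Finite.exists_max fun b => bundleValue (U s) (t b)
  have hlt : bundleValue (U s) (A s) < bundleValue (U s) (t b) := by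
    rw [ht, not_le] at hb₀
    exact hb₀.trans_le (hb b₀)
  have hbs : b ≠ s := by
    rintro rfl
    exact hlt.not_ge (bundleValue_mono _ (htsub b))
  have hne : (A b).Nonempty := by
    by_contra h
    rw [Finset.not_nonempty_iff_eq_empty] at h
    have := htsub b
    rw [h, Finset.subset_empty] at this
    rw [this] at hlt
    simp [bundleValue] at hlt
  set A' : α → Finset (Fin m) := Function.update (Function.update A s (t b)) b (A s) with hA'
  have hA'b : A' b = A s := Function.update_self ..
  have hA's : A' s = t b := by
    rw [hA', Function.update_of_ne hbs.symm, Function.update_self]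
  have hA'o : ∀ a, a ≠ s → a ≠ b → A' a = A a := fun a h1 h2 => by
    rw [hA', Function.update_of_ne h2, Function.update_of_ne h1]
  have hsub : ∀ a, A' a ⊆ A (Equiv.swap s b a) := by
    intro a
    rcases eq_or_ne a s with rfl | h1
    · rw [hA's, Equiv.swap_apply_left]; exact htsub b
    rcases eq_or_ne a b with rfl | h2
    · rw [hA'b, Equiv.swap_apply_right]
    · rw [hA'o a h1 h2, Equiv.swap_apply_of_ne_of_ne h1 h2]
  refine ih _ ?_ A' b ?_ ?_ ?_ ?_ rfl
  · calc ∑ a, (A' a).card < ∑ a, (A (Equiv.swap s b a)).card := by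
          refine Finset.sum_lt_sum (fun a _ => Finset.card_le_card (hsub a))
            ⟨s, Finset.mem_univ s, ?_⟩
          rw [hA's, Equiv.swap_apply_left]
          exact htcard b hne
      _ = ∑ a, (A a).card := Equiv.sum_comp (Equiv.swap s b) fun a => (A a).card
  · intro a a' h
    exact (hdisj ((Equiv.injective (Equiv.swap s b)).ne h)).mono (hsub a) (hsub a')
  · intro a hab a'
    rcases eq_or_ne a s with rfl | has
    · rw [hA's]
      exact ((ht _ _).2 (hb _)).mono (hsub a') le_rfl
    · rw [hA'o a has hab]
      exact (hEF a has _).mono (hsub a') le_rfl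
  · rwa [hA'b]
  · rcases eq_or_ne i s with rfl | h1
    · rw [hA's]; exact hs.trans hlt.le
    rcases eq_or_ne i b with rfl | h2
    · rwa [hA'b]
    · rwa [hA'o i h1 h2]

/-- If everybody is envied, following enviers leads to a cycle; a permutation that passes the
bundles along the cycles harms nobody and benefits somebody. -/
lemma exists_perm_of_forall_envied {α : Type} [Fintype α] [Nonempty α] [DecidableEq α] {m : ℕ}
    (U : α → GoodsValuation m) (A : α → Finset (Fin m))
    (h : ∀ a, ∃ b, bundleValue (U b) (A b) < bundleValue (U b) (A a)) :
    ∃ σ : Equiv.Perm α, (∀ a, bundleValue (U a) (A a) ≤ bundleValue (U a) (A (σ a))) ∧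
      ∃ a, bundleValue (U a) (A a) < bundleValue (U a) (A (σ a)) := by
  classical
  choose φ hφ using h
  set τ : Equiv.Perm α := Equiv.Perm.ofSubtype (Function.bijOn_periodicPts φ).equiv with hτ
  have hper : ∀ a ∈ Function.periodicPts φ, τ a = φ a := fun a ha => by
    rw [hτ, Equiv.Perm.ofSubtype_apply_of_mem _ ha]; rfl
  have hnper : ∀ a, a ∉ Function.periodicPts φ → τ a = a := fun a ha =>
    Equiv.Perm.ofSubtype_apply_of_not_mem _ ha
  obtain ⟨c, hc⟩ : ∃ c, c ∈ Function.periodicPts φ := by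
    obtain ⟨a⟩ := ‹Nonempty α›
    obtain ⟨k, l, hkl, he⟩ := Finite.exists_ne_map_eq_of_infinite fun k : ℕ => φ^[k] a
    wlog hlt : k < l generalizing k l
    · exact this l k hkl.symm he.symm (by omega)
    refine ⟨φ^[k] a, Function.mk_mem_periodicPts (n := l - k) (by omega) ?_⟩
    rw [Function.IsPeriodicPt, Function.IsFixedPt, ← Function.iterate_add_apply,
      Nat.sub_add_cancel hlt.le]
    exact he.symm
  have hlt : ∀ a ∈ Function.periodicPts φ,
      bundleValue (U (τ a)) (A (τ a)) < bundleValue (U (τ a)) (A (τ.symm (τ a))) := by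
    intro a ha
    rw [Equiv.symm_apply_apply, hper a ha]
    exact hφ a
  refine ⟨τ.symm, fun b => ?_, τ c, hlt c hc⟩
  obtain ⟨a, rfl⟩ := τ.surjective b
  by_cases ha : a ∈ Function.periodicPts φ
  · exact (hlt a ha).le
  · rw [Equiv.symm_apply_apply, hnper a ha]

/-- Among the partial allocations that harm nobody, one with the largest welfare and, subject to
that, the largest number of allocated goods is complete: otherwise a further good could be given
to an unenvied agent, or, if there is none, an exchange of bundles would increase the welfare. -/
lemma IsPartialEF1.exists_complete {α : Type} [Fintype α] [Nonempty α] [DecidableEq α] {m : ℕ}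
    {U : α → GoodsValuation m} {A : α → Finset (Fin m)} (hA : IsPartialEF1 U A) :
    ∃ A', IsPartialEF1 U A' ∧ (∀ a, bundleValue (U a) (A a) ≤ bundleValue (U a) (A' a)) ∧
      ∀ g, ∃ a, g ∈ A' a := by
  obtain ⟨B, ⟨hB, hge⟩, hmax⟩ := Set.exists_max_image
    {B | IsPartialEF1 U B ∧ ∀ a, bundleValue (U a) (A a) ≤ bundleValue (U a) (B a)}
    (fun B => toLex (∑ a, bundleValue (U a) (B a), ∑ a, (B a).card)) (Set.toFinite _)
    ⟨A, hA, fun _ => le_rfl⟩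
  refine ⟨B, hB, hge, ?_⟩
  by_contra! hg
  obtain ⟨g, hg⟩ := hg
  by_cases hun : ∃ a, ∀ b, bundleValue (U b) (B a) ≤ bundleValue (U b) (B b)
  · obtain ⟨a, ha⟩ := hun
    set C := Function.update B a (insert g (B a)) with hC
    have hCa : C a = insert g (B a) := Function.update_self ..
    have hCo : ∀ b, b ≠ a → C b = B b := fun b hb => Function.update_of_ne hb ..
    have hsub : ∀ b, B b ⊆ C b := by
      intro b
      rcases eq_or_ne b a with rfl | hb
      · rw [hCa]; exact Finset.subset_insert _ _
      · rw [hCo b hb]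
    have hCmem : IsPartialEF1 U C := by
      refine ⟨fun x y hxy => ?_, fun x y => ?_⟩
      · rcases eq_or_ne x a with rfl | hx
        · rw [hCa, hCo y hxy.symm, Finset.disjoint_insert_left]
          exact ⟨hg y, hB.1 hxy⟩
        rcases eq_or_ne y a with rfl | hy
        · rw [hCa, hCo x hx, Finset.disjoint_insert_right]
          exact ⟨hg x, hB.1 hxy⟩
        · rw [hCo x hx, hCo y hy]
          exact hB.1 hxy
      · rcases eq_or_ne y a with rfl | hy
        · rw [hCa]
          refine Or.inr ⟨g, Finset.mem_insert_self _ _, ?_⟩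
          rw [Finset.erase_insert (hg y)]
          exact (ha x).trans (bundleValue_mono _ (hsub x))
        · rw [hCo y hy]
          exact (hB.2 x y).mono subset_rfl (bundleValue_mono _ (hsub x))
    refine (hmax C ⟨hCmem, fun b => (hge b).trans (bundleValue_mono _ (hsub b))⟩).not_gt ?_
    have hcard : ∑ b, (B b).card < ∑ b, (C b).card := by
      refine Finset.sum_lt_sum (fun b _ => Finset.card_le_card (hsub b)) ⟨a, Finset.mem_univ a, ?_⟩
      rw [hCa, Finset.card_insert_of_notMem (hg a)]
      exact Nat.lt_succ_self _
    have hsum : ∑ b, bundleValue (U b) (B b) ≤ ∑ b, bundleValue (U b) (C b) :=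
      Finset.sum_le_sum fun b _ => bundleValue_mono _ (hsub b)
    rw [Prod.Lex.toLex_lt_toLex]
    rcases hsum.lt_or_eq with h | h
    · exact Or.inl h
    · exact Or.inr ⟨h, hcard⟩
  · push Not at hun
    obtain ⟨σ, hle, a, hlt⟩ := exists_perm_of_forall_envied U B hun
    have hmem : IsPartialEF1 U (B ∘ σ) :=
      ⟨fun x y hxy => hB.1 (σ.injective.ne hxy),
        fun x y => (hB.2 x (σ y)).mono subset_rfl (hle x)⟩
    refine (hmax (B ∘ σ) ⟨hmem, fun b => (hge b).trans (hle b)⟩).not_gt ?_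
    rw [Prod.Lex.toLex_lt_toLex]
    exact Or.inl (Finset.sum_lt_sum (fun b _ => hle b) ⟨a, Finset.mem_univ a, hlt⟩)

/-! ### The RAT-degree of Volatile Priority mechanisms -/

/-- Suppose that agent `j` receives the good `g` in `B`, that the other agents except `i` accept
their bundles up to one good, and that nobody envies `i`. Then `g` can be moved to `i`, and the
goods can be rearranged among the agents other than `j`, such that the result is EF1, nobody
envies `j`, who values only `g`, and `i` keeps the value of her bundle including `g`. Nothing is
assumed about the envy of `i` in `B`. -/
lemma exists_mem_ef1Unenvied_ge {n m : ℕ} (V : Profile n m) {i j : Fin n} (hij : i ≠ j)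
    (g : Fin m) (hj : ∀ h, h ≠ g → V j h = 0) (B : Allocation n m) (hBg : B g = j)
    (hEF : ∀ a, a ≠ i → ∀ b,
      WorthAtMostUpToOne (V a) (bundle B b) (bundleValue (V a) (bundle B a)))
    (hun : ∀ a, bundleValue (V a) (bundle B i) ≤ bundleValue (V a) (bundle B a)) :
    ∃ A ∈ ef1Unenvied V j,
      bundleValue (V i) (bundle B i) + V i g ≤ bundleValue (V i) (bundle A i) := by
  set i' : {a : Fin n // a ≠ j} := ⟨i, hij⟩ with hi'
  have : Nonempty {a : Fin n // a ≠ j} := ⟨i'⟩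
  set U : {a : Fin n // a ≠ j} → GoodsValuation m := fun a => V a with hU
  have hgb : ∀ a : Fin n, a ≠ j → g ∉ bundle B a := fun a ha h => by
    simp only [bundle, Finset.mem_filter, Finset.mem_univ, true_and] at h
    exact ha (h.symm.trans hBg)
  have hdisjB : ∀ a b : Fin n, a ≠ b → Disjoint (bundle B a) (bundle B b) := fun a b hab => by
    rw [Finset.disjoint_left]
    intro h ha hb
    simp only [bundle, Finset.mem_filter, Finset.mem_univ, true_and] at ha hb
    exact hab (ha.symm.trans hb)
  set Y : {a : Fin n // a ≠ j} → Finset (Fin m) :=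
    Function.update (fun a => bundle B a) i' (insert g (bundle B i)) with hY
  have hYi : Y i' = insert g (bundle B i) := Function.update_self ..
  have hYo : ∀ a, a ≠ i' → Y a = bundle B a := fun a ha => Function.update_of_ne ha ..
  have hval : bundleValue (V i) (bundle B i) + V i g = bundleValue (U i') (Y i') := by
    rw [hYi, bundleValue, bundleValue, Finset.sum_insert (hgb i hij), add_comm]
  have hYdisj : Pairwise fun a b => Disjoint (Y a) (Y b) := by
    intro a b hab
    have hab' : (a : Fin n) ≠ b := fun h => hab (Subtype.ext h)
    rcases eq_or_ne a i' with rfl | ha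
    · rw [hYi, hYo b hab.symm, Finset.disjoint_insert_left]
      exact ⟨hgb b b.2, hdisjB _ _ hab'⟩
    rcases eq_or_ne b i' with rfl | hb
    · rw [hYi, hYo a ha, Finset.disjoint_insert_right]
      exact ⟨hgb a a.2, hdisjB _ _ hab'⟩
    · rw [hYo a ha, hYo b hb]
      exact hdisjB _ _ hab'
  have hYEF : ∀ a, a ≠ i' → ∀ b, WorthAtMostUpToOne (U a) (Y b) (bundleValue (U a) (Y a)) := by
    intro a ha b
    rw [hYo a ha]
    rcases eq_or_ne b i' with rfl | hb
    · rw [hYi]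
      refine Or.inr ⟨g, Finset.mem_insert_self _ _, ?_⟩
      rw [Finset.erase_insert (hgb i hij)]
      exact hun a
    · rw [hYo b hb]
      exact hEF a (fun h => ha (Subtype.ext h)) b
  obtain ⟨Y', hY', hY'i⟩ := exists_isPartialEF1_of_forall_ne U i' _ Y i' hYdisj hYEF le_rfl le_rfl
  obtain ⟨Z, hZ, hZge, hZcov⟩ := hY'.exists_complete
  choose A hA using hZcov
  have hbA : ∀ a : {a : Fin n // a ≠ j}, bundle (fun h => (A h : Fin n)) a = Z a := by
    intro a
    ext h
    simp only [bundle, Finset.mem_filter, Finset.mem_univ, true_and]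
    refine ⟨fun e => ?_, fun hh => ?_⟩
    · rw [← Subtype.ext e]; exact hA h
    · by_contra hne
      exact Finset.disjoint_left.1 (hZ.1 fun e => hne (congrArg Subtype.val e)) (hA h) hh
  have hbj : bundle (fun h => (A h : Fin n)) j = ∅ :=
    Finset.filter_eq_empty_iff.2 fun h _ => (A h).2
  refine ⟨fun h => A h, ⟨fun a b => ?_, fun a => ?_⟩, ?_⟩
  · rcases eq_or_ne b j with rfl | hb
    · exact Or.inl (by rw [hbj]; simp [bundleValue])
    rcases eq_or_ne a j with rfl | ha
    · by_cases hg : g ∈ bundle (fun h => (A h : Fin n)) b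
      · refine Or.inr ⟨g, hg, le_of_eq_of_le (Finset.sum_eq_zero fun h hh => ?_) zero_le⟩
        exact hj h (Finset.ne_of_mem_erase hh)
      · refine Or.inl (le_of_eq_of_le (Finset.sum_eq_zero fun h hh => hj h ?_) zero_le)
        rintro rfl
        exact hg hh
    · have := hZ.2 ⟨a, ha⟩ ⟨b, hb⟩
      rw [← hbA, ← hbA] at this
      exact this
  · rw [hbj]; simp [bundleValue]
  · rw [hval]
    exact (hY'i.trans (hZge i')).trans_eq (by rw [← hbA i'])

/-- If `j` is favored and values only `g`, and somebody else is unfavored, then `j` receives `g`. -/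
lemma IsPriorityMechanism.apply_eq_of_favored {n m : ℕ} {Γ : PriorityRule n m}
    {f : Profile n m → Allocation n m} (hf : IsPriorityMechanism Γ f) {V : Profile n m}
    {i j : Fin n} (hij : i ≠ j) (hΓ : Γ V = (j, i)) {g : Fin m} (hg : 0 < V j g)
    (hj : ∀ h, h ≠ g → V j h = 0) : f V g = j := by
  obtain ⟨A, hA, hbest⟩ := exists_mem_ef1Unenvied_best V hij
  have h := (hf V).2 A (by rwa [hΓ])
  simp only [hΓ] at h
  by_contra hne
  refine (hg.trans_le ((hbest g).trans h)).ne' (Finset.sum_eq_zero fun h hh => hj h ?_)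
  rintro rfl
  exact hne (by simpa [bundle] using hh)

/-- If at least one agent `j` besides `i` is unknown to `i`, no manipulation of `i` is both
profitable and safe: with the report of `j` on a single good that `i` values, the truth may make
`i` favored and `j` unfavored, and the manipulation the other way round. -/
lemma not_knownAgentsSafelyManipulable {n m : ℕ} {Γ : PriorityRule n m} (hΓ : IsVolatile Γ)
    {f : Profile n m → Allocation n m} (hf : IsPriorityMechanism Γ f) {k : ℕ} (hk : k + 1 < n) :
    ¬ KnownAgentsSafelyManipulable (D := fun _ : Fin n => GoodsValuation m)
      (goodsUtility n m) f k := by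
  rintro ⟨i, K, hiK, hK, Q, T, P, hPT, ⟨R, hR⟩, hsafe⟩
  obtain ⟨g, hg⟩ : ∃ g, 0 < T g := by
    by_contra! h
    have hT : ∀ S : Finset (Fin m), bundleValue T S = 0 :=
      fun S => Finset.sum_eq_zero fun g _ => le_antisymm (h g) zero_le
    simp [goodsUtility, hT] at hR
  obtain ⟨j, hj⟩ : ∃ j, j ∉ insert i K := by
    by_contra! h
    have h1 := Finset.card_insert_of_notMem hiK
    rw [Finset.eq_univ_iff_forall.2 h, Finset.card_univ, Fintype.card_fin] at h1
    omega
  rw [Finset.mem_insert, not_or] at hj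
  obtain ⟨hji, hjK⟩ := hj
  have hij : i ≠ j := Ne.symm hji
  obtain ⟨w, hwg, hw0, hΓT, hΓP⟩ := hΓ i j i j j i hij hij hji g (K.piecewise Q 0) T P hPT.symm
  have hprof : ∀ v : GoodsValuation m,
      combinedProfile (D := fun _ : Fin n => GoodsValuation m) i K v Q (Function.update 0 j w) =
        Function.update (Function.update (K.piecewise Q 0) i v) j w := by
    intro v
    rw [Function.update_comm hij, combinedProfile, Finset.update_piecewise_of_notMem _ _ _ hjK]
  have hs := hsafe (Function.update 0 j w)
  simp only [hprof, goodsUtility, NNReal.coe_le_coe] at hs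
  set VT : Profile n m := Function.update (Function.update (K.piecewise Q 0) i T) j w with hVT
  set VP : Profile n m := Function.update (Function.update (K.piecewise Q 0) i P) j w with hVP
  have hTi : VT i = T := by rw [hVT, Function.update_of_ne hij, Function.update_self]
  have hTj : VT j = w := Function.update_self ..
  have hPj : VP j = w := Function.update_self ..
  have hTP : ∀ a, a ≠ i → VT a = VP a := fun a ha => by
    rcases eq_or_ne a j with rfl | haj
    · rw [hTj, hPj]
    · simp only [hVT, hVP, Function.update_of_ne haj, Function.update_of_ne ha]
  have hBg : f VP g = j := hf.apply_eq_of_favored hij hΓP (by rwa [hPj]) (by rwa [hPj])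
  obtain ⟨hEF, hun⟩ := (hf VP).1
  obtain ⟨A, hA, hAi⟩ := exists_mem_ef1Unenvied_ge VT hij g (by rwa [hTj]) (f VP) hBg
    (fun a ha b => by rw [hTP a ha]; exact hEF a b)
    (fun a => by
      rcases eq_or_ne a i with rfl | ha
      · exact le_rfl
      · rw [hTP a ha]
        simpa only [hΓP] using hun a)
  have hmax := (hf VT).2 A (by rwa [hΓT])
  simp only [hΓT, hTi] at hmax
  rw [hTi] at hAi
  exact (lt_add_of_pos_right _ hg).not_ge (hAi.trans (hmax.trans hs))

/-- If agent `i` is favored, `j` is unfavored and values at most one good, and the other agents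
value nothing, then `i` receives everything that she values. -/
lemma IsPriorityMechanism.bundleValue_univ_le {n m : ℕ} {Γ : PriorityRule n m}
    {f : Profile n m → Allocation n m} (hf : IsPriorityMechanism Γ f) {V : Profile n m}
    {i j : Fin n} (hij : i ≠ j) (hΓ : Γ V = (i, j)) {g : Fin m} (hj : ∀ h, h ≠ g → V j h = 0)
    (hV : ∀ a, a ≠ i → a ≠ j → V a = 0) :
    bundleValue (V i) Finset.univ ≤ bundleValue (V i) (bundle (f V) i) := by
  have hi : bundle (fun _ : Fin m => i) i = Finset.univ := by simp [bundle]
  have hne : ∀ a, a ≠ i → bundle (fun _ : Fin m => i) a = ∅ := fun a ha => by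
    simp [bundle, ha.symm]
  have hmem : (fun _ => i : Allocation n m) ∈ ef1Unenvied V j := by
    refine ⟨fun a b => ?_, fun a => by rw [hne j hij.symm]; simp [bundleValue]⟩
    rcases eq_or_ne b i with rfl | hb
    · rcases eq_or_ne a b with rfl | ha
      · exact Or.inl le_rfl
      rcases eq_or_ne a j with rfl | haj
      · refine Or.inr ⟨g, by rw [hi]; exact Finset.mem_univ g, ?_⟩
        refine le_of_eq_of_le (Finset.sum_eq_zero fun h hh => ?_) zero_le
        exact hj h (Finset.ne_of_mem_erase hh)
      · exact Or.inl (by simp [hV a ha haj, bundleValue])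
    · exact Or.inl (by rw [hne b hb]; simp [bundleValue])
  have h := (hf V).2 _ (by rwa [hΓ])
  simpa only [hΓ, hi] using h

/-- An agent who knows all other reports can profit: if everybody else values nothing, except for
one good of `j`, doubling the own valuation may change the roles of `i` and `j`. -/
lemma knownAgentsSafelyManipulable_sub_one {n m : ℕ} (hn : 2 ≤ n) (hm : 1 ≤ m)
    {Γ : PriorityRule n m} (hΓ : IsVolatile Γ) {f : Profile n m → Allocation n m}
    (hf : IsPriorityMechanism Γ f) :
    KnownAgentsSafelyManipulable (D := fun _ : Fin n => GoodsValuation m)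
      (goodsUtility n m) f (n - 1) := by
  set i : Fin n := ⟨0, by omega⟩
  set j : Fin n := ⟨1, by omega⟩
  have hij : i ≠ j := Fin.ne_of_val_ne (by simp [i, j])
  set g : Fin m := ⟨0, hm⟩
  have hne : (2 : GoodsValuation m) ≠ 1 := fun h => by simpa using congrFun h g
  obtain ⟨w, hwg, hw0, hΓ1, hΓ2⟩ := hΓ i j j i i j hij hij.symm hij g 0 1 2 hne.symm
  set V1 : Profile n m := Function.update (Function.update 0 i 1) j w with hV1
  set V2 : Profile n m := Function.update (Function.update 0 i 2) j w with hV2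
  have h1j : V1 j = w := Function.update_self ..
  have h2j : V2 j = w := Function.update_self ..
  have h2i : V2 i = 2 := by rw [hV2, Function.update_of_ne hij, Function.update_self]
  have hprof : ∀ (v : GoodsValuation m) (R : Profile n m),
      combinedProfile (D := fun _ : Fin n => GoodsValuation m) i (Finset.univ.erase i) v
        (Function.update 0 j w) R = Function.update (Function.update (0 : Profile n m) i v) j w := by
    intro v R
    rw [Function.update_comm hij, combinedProfile]
    ext a : 1
    rcases eq_or_ne a i with rfl | ha
    · simp
    · rw [Function.update_of_ne ha, Function.update_of_ne ha,
        Finset.piecewise_eq_of_mem _ _ _ (by simp [ha])]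
  have hlt : goodsUtility n m i 1 (f V1) < goodsUtility n m i 1 (f V2) := by
    rw [goodsUtility, goodsUtility, NNReal.coe_lt_coe]
    have hg : f V1 g = j := hf.apply_eq_of_favored hij hΓ1 (by rwa [h1j]) (by rwa [h1j])
    have hall := hf.bundleValue_univ_le hij hΓ2 (g := g) (by rwa [h2j])
      fun a ha haj => by simp [hV2, Function.update_of_ne haj, Function.update_of_ne ha]
    have hdouble : ∀ S, bundleValue (2 : GoodsValuation m) S = 2 * bundleValue 1 S := fun S => by
      simp [bundleValue, mul_comm]
    rw [h2i, hdouble, hdouble, mul_le_mul_iff_right₀ two_pos] at hall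
    refine lt_of_lt_of_le ?_ hall
    refine Finset.sum_lt_sum_of_subset (Finset.subset_univ _) (Finset.mem_univ g) ?_ ?_ ?_
    · simp [bundle, hg, hij.symm]
    · simp
    · simp
  refine ⟨i, Finset.univ.erase i, Finset.notMem_erase _ _, by simp,
    Function.update 0 j w, 1, 2, hne, ⟨0, ?_⟩, fun R => ?_⟩
  · rw [hprof, hprof]; exact hlt
  · rw [hprof, hprof]; exact hlt.le

theorem mainTheorem2 (n m : ℕ) (hn : 2 ≤ n) (hm : 1 ≤ m) :
    (IsVolatile (binaryPriority (m := m) hn hm) ∧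
      ∀ V : Profile n m, (binaryPriority hn hm V).1 ≠ (binaryPriority hn hm V).2) ∧
    (∀ Γ : PriorityRule n m, ∃ f : Profile n m → Allocation n m, IsPriorityMechanism Γ f) ∧
    (∀ Γ : PriorityRule n m, IsVolatile Γ →
      ∀ f : Profile n m → Allocation n m, IsPriorityMechanism Γ f →
        (∀ V : Profile n m, IsEF1 V (f V)) ∧
        RATDegree (D := fun _ : Fin n => GoodsValuation m) (goodsUtility n m) f = n - 1) := by
  classical
  refine ⟨⟨isVolatile_binaryPriority hn hm, binaryPriority_fst_ne_snd hn hm⟩,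
    exists_isPriorityMechanism, fun Γ hΓ f hf => ⟨fun V => (hf V).1.1, ?_⟩⟩
  have h := knownAgentsSafelyManipulable_sub_one hn hm hΓ hf
  rw [RATDegree, dif_pos ⟨n - 1, h⟩, Nat.find_eq_iff]
  exact ⟨h, fun k hk => not_knownAgentsSafelyManipulable hΓ hf (by omega)⟩
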